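/- Let $\mathbb{N}=\{1,2,\dots\}$. A triple $\delta=(\alpha,\beta,\gamma)$ consists of an infinite word $\alpha$ over $\{0,1,2,3\}$, a bond-set $\beta$, i.e. a symmetric subset of $\{(x,y)\in\mathbb{N}^2:|x-y|>1\}$, and an infinite binary word $\gamma$. The graph $\mathcal{P}^\delta$ has vertices $v_{i,j}$ ($i,j\in\mathbb{N}$; $i$ is the column, $j$ the row) and the following edges only. (a) Between columns $i$ and $i+1$: $v_{i,j}\sim v_{i+1,k}$ if and only if $j=k$ (when $\alpha_i=0$), $j\ne k$ (when $\alpha_i=1$), $j\ge k$ (when $\alpha_i=2$), $j<k$ (when $\alpha_i=3$). (b) If $(i,j)\in\beta$, every vertex of column $i$ is adjacent to every vertex of column $j$. (c) Column $i$ is a clique if $\gamma_i=1$ and independent if $\gamma_i=0$. The class $\mathcal{G}^\delta$ is the hereditary class of all finite induced subgraphs of $\mathcal{P}^\delta$ (up to isomorphism). The clique-width of a finite graph is the least number of labels needed to construct it by creating labelled vertices, joining all vertices labelled $i$ to all vertices labelled $j$ (for distinct $i,j$), relabelling $i\to j$, and taking disjoint unions. For linear clique-width, disjoint unions may only be used to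 add a single new vertex to the graph constructed so far. For a graph $G$ and a vertex set $U$, let $\mu(G,U)$ be the number of classes of $U$ under having the same neighbourhood outside $U$. * For finite $Q\subseteq\mathbb{N}$, let $T^\delta(Q)$ be the subgraph of $\mathcal{P}^\delta$ induced on $\{v_{i,1},v_{i,2}:i\in Q\}$, and let $\mathcal{N}^\delta(Q)=\mu(T^\delta(Q),\{v_{i,1}:i\in Q\})$. * Let $B^\beta([1,n])$ be the graph on $[1,n]$ with edges $xy$ for $(x,y)\in\beta$, and for $n\ge 2$ let $\mathcal{M}^\beta(n)=\sup_{1\le m<n}\mu(B^\beta([1,n]),[1,m])$. We say that $\mathcal{M}^\beta$ is bounded if $\mathcal{M}^\beta(n)$ is bounded over all $n\ge2$. * For $k\ge2$, the $k$-factor of $\delta$ on the columns $[x,x+k-1]$ is the same as that on $[y,y+k-1]$ if $\alpha_{x+i}=\alpha_{y+i}$ for $0\le i\le k-2$, $\gamma_{x+i}=\gamma_{y+i}$ for $0\le i\le k-1$, and $(x+i,x+j)\in\beta\Leftrightarrow(y+i,y+j)\in\beta$ for $0\le i,j\le k-1$. The triple $\delta$ is recurrent if for all $k\ge 2$ every $k$-factor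 occurs in it infinitely often. * Let $\delta$ be recurrent and let $\delta^*$ be a $k$-factor of $\delta$. Put $t_0=0$, and let $t_i$ be the least $t>t_{i-1}+k$ such that a copy of $\delta^*$ ends in column $t$. Let $q_1=[1,t_1]$ and $q_i=[t_{i-1}-k+1,t_i]$ for $i\ge2$. We say that $\mathcal{N}^\delta_*$ is bounded for $\delta^*$ if $\mathcal{N}^\delta_*(n)=\sup_{1\le i\le n}\mathcal{N}^\delta(q_i)$ is bounded as $n\to\infty$. Let $\Delta$ be the set of triples $\delta$ for which $\mathcal{G}^\delta$ has unbounded clique-width. Let $\Delta_{min}$ be the set of $\delta\in\Delta$ such that $\delta$ is recurrent, $\mathcal{N}^\delta_*$ is bounded for every $k$-factor $\delta^*$ of $\delta$ and every $k\ge2$, and $\mathcal{M}^\beta$ is bounded. **Theorem.** If $\delta\in\Delta_{min}$, then $\mathcal{G}^\delta$ is a minimal hereditary class of unbounded clique-width and also a minimal hereditary class of unbounded linear clique-width. That is, $\mathcal{G}^\delta$ is hereditary, it has unbounded clique-width and unbounded linear clique-width, and every proper hereditary subclass of $\mathcal{G}^\delta$ has bounded clique-width and bounded linear clique-width. -/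

import Mathlib

namespace GridClass

/-! ### Classes of finite graphs -/

/-- A class of finite graphs: for every finite vertex type, a set of graphs on it. -/
def GraphClass : Type 1 := ∀ (V : Type) [Finite V], Set (SimpleGraph V)

/-- A class is hereditary if it is closed under induced subgraphs (up to isomorphism); in
particular it is closed under isomorphism. -/
def GraphClass.IsHereditary (C : GraphClass) : Prop :=
  ∀ (V W : Type) [Finite V] [Finite W] (H : SimpleGraph V) (G : SimpleGraph W),
    G ∈ C W → Nonempty (H ↪g G) → H ∈ C V

/-- `C` is a subclass of `D`. -/
def GraphClass.IsSubclass (C D : GraphClass) : Prop :=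
  ∀ (V : Type) [Finite V] (G : SimpleGraph V), G ∈ C V → G ∈ D V

/-- `C` is a proper subclass of `D`. -/
def GraphClass.IsProperSubclass (C D : GraphClass) : Prop :=
  C.IsSubclass D ∧ ¬ D.IsSubclass C

/-! ### Clique-width and linear clique-width -/

/-- Clique-width expressions over the label set `Fin k`: creation of a vertex with label `i`;
joining all vertices labelled `i` to all vertices labelled `j` for distinct `i`, `j`;
relabelling `i → j`; disjoint union. -/
inductive CWExpr (k : ℕ) : Type
  | vertex (i : Fin k) : CWExpr k
  | join (i j : Fin k) (hij : i ≠ j) (e : CWExpr k) : CWExpr k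
  | relabel (i j : Fin k) (e : CWExpr k) : CWExpr k
  | union (e f : CWExpr k) : CWExpr k

/-- The vertices of the labelled graph built by an expression. -/
def CWExpr.Vert {k : ℕ} : CWExpr k → Type
  | .vertex _ => Unit
  | .join _ _ _ e => e.Vert
  | .relabel _ _ e => e.Vert
  | .union e f => e.Vert ⊕ f.Vert

/-- The labels of the labelled graph built by an expression. -/
def CWExpr.label {k : ℕ} : (e : CWExpr k) → e.Vert → Fin k
  | .vertex i => fun _ => i
  | .join _ _ _ e => e.label
  | .relabel i j e => fun v => if e.label v = i then j else e.label v
  | .union e f => Sum.elim e.label f.label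

/-- The graph built by an expression. -/
def CWExpr.graph {k : ℕ} : (e : CWExpr k) → SimpleGraph e.Vert
  | .vertex _ => (⊥ : SimpleGraph Unit)
  | .join i j _ e => e.graph ⊔ SimpleGraph.fromRel (fun u v => e.label u = i ∧ e.label v = j)
  | .relabel _ _ e => e.graph
  | .union e f => e.graph ⊕g f.graph

/-- An expression is linear if the disjoint union is only used to add one newly created
vertex to the graph constructed so far (so that its tree is a caterpillar). -/
def CWExpr.IsLinear {k : ℕ} : CWExpr k → Prop
  | .vertex _ => True
  | .join _ _ _ e => e.IsLinear
  | .relabel _ _ e => e.IsLinear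
  | .union e f => e.IsLinear ∧ ∃ i, f = .vertex i

/-- The clique-width of a finite graph (the graph without vertices has clique-width `0`). -/
noncomputable def cwd {V : Type} (G : SimpleGraph V) : ℕ :=
  sInf {k : ℕ | ∃ e : CWExpr k, Nonempty (e.graph ≃g G)}

/-- The linear clique-width of a finite graph (`0` for the graph without vertices). -/
noncomputable def lcw {V : Type} (G : SimpleGraph V) : ℕ :=
  sInf {k : ℕ | ∃ e : CWExpr k, e.IsLinear ∧ Nonempty (e.graph ≃g G)}

/-- The class `C` has bounded clique-width. -/
def GraphClass.BoundedCwd (C : GraphClass) : Prop :=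
  ∃ K : ℕ, ∀ (V : Type) [Finite V] (G : SimpleGraph V), G ∈ C V → cwd G ≤ K

/-- The class `C` has bounded linear clique-width. -/
def GraphClass.BoundedLcw (C : GraphClass) : Prop :=
  ∃ K : ℕ, ∀ (V : Type) [Finite V] (G : SimpleGraph V), G ∈ C V → lcw G ≤ K

/-- `C` is a minimal hereditary class of unbounded clique-width. -/
def GraphClass.IsMinimalUnboundedCwd (C : GraphClass) : Prop :=
  C.IsHereditary ∧ ¬ C.BoundedCwd ∧
    ∀ D : GraphClass, D.IsHereditary → D.IsProperSubclass C → D.BoundedCwd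

/-- `C` is a minimal hereditary class of unbounded linear clique-width. -/
def GraphClass.IsMinimalUnboundedLcw (C : GraphClass) : Prop :=
  C.IsHereditary ∧ ¬ C.BoundedLcw ∧
    ∀ D : GraphClass, D.IsHereditary → D.IsProperSubclass C → D.BoundedLcw

/-! ### Triples and their grid graphs

Columns and rows are numbered from `0` (instead of from `1`), so `α i` describes the edges
between the columns `i` and `i + 1`, and the interval `[1, n]` becomes `{0, …, n - 1}`. -/

/-- A triple `δ = (α, β, γ)`: an infinite word over `{0, 1, 2, 3}`, a bond-set, and an infinite
binary word. -/
structure Triple where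
  α : ℕ → Fin 4
  β : Set (ℕ × ℕ)
  γ : ℕ → Fin 2
  /-- The bond-set is symmetric. -/
  β_symm : ∀ x y : ℕ, (x, y) ∈ β → (y, x) ∈ β
  /-- Bonds join columns at distance greater than one. -/
  β_dist : ∀ x y : ℕ, (x, y) ∈ β → 1 < |(x : ℤ) - (y : ℤ)|

/-- Adjacency between row `j` of a column and row `k` of the next column, for each letter. -/
def linkAdj (a : Fin 4) (j k : ℕ) : Prop :=
  (a = 0 ∧ j = k) ∨ (a = 1 ∧ j ≠ k) ∨ (a = 2 ∧ k ≤ j) ∨ (a = 3 ∧ j < k)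

namespace Triple

/-- The infinite graph on the grid; `(i, j)` is the vertex in column `i` and row `j`. -/
def grid (δ : Triple) : SimpleGraph (ℕ × ℕ) where
  Adj p q :=
    (q.1 = p.1 + 1 ∧ linkAdj (δ.α p.1) p.2 q.2) ∨
    (p.1 = q.1 + 1 ∧ linkAdj (δ.α q.1) q.2 p.2) ∨
    (p.1, q.1) ∈ δ.β ∨
    (p.1 = q.1 ∧ p.2 ≠ q.2 ∧ δ.γ p.1 = 1)
  symm := ⟨by
    rintro p q (h | h | h | ⟨h1, h2, h3⟩)
    · exact Or.inr (Or.inl h)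
    · exact Or.inl h
    · exact Or.inr (Or.inr (Or.inl (δ.β_symm _ _ h)))
    · exact Or.inr (Or.inr (Or.inr ⟨h1.symm, h2.symm, h1 ▸ h3⟩))⟩
  loopless := ⟨by
    rintro p (h | h | h | h)
    · omega
    · omega
    · simpa using δ.β_dist _ _ h
    · exact h.2.1 rfl⟩

/-- The class of all finite induced subgraphs of the grid graph (up to isomorphism). -/
def graphClass (δ : Triple) : GraphClass :=
  fun V _ => {G : SimpleGraph V | Nonempty (G ↪g δ.grid)}

/-- The factors of `δ` on the `k` columns starting at `x` and at `y` are the same. -/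
def SameFactor (δ : Triple) (k x y : ℕ) : Prop :=
  (∀ i, i + 1 < k → δ.α (x + i) = δ.α (y + i)) ∧
  (∀ i j, i < k → j < k → ((x + i, x + j) ∈ δ.β ↔ (y + i, y + j) ∈ δ.β)) ∧
  (∀ i, i < k → δ.γ (x + i) = δ.γ (y + i))

/-- Every `k`-factor (`k ≥ 2`) of `δ` occurs infinitely many times. -/
def IsRecurrent (δ : Triple) : Prop :=
  ∀ k, 2 ≤ k → ∀ j, {x : ℕ | δ.SameFactor k j x}.Infinite

end Triple

/-! ### Neighbourhood parameters -/

/-- `μ(G, U)`: the number of classes of `U` under having the same neighbourhood outside `U`. -/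
noncomputable def mu {V : Type} (G : SimpleGraph V) (U : Set V) : ℕ :=
  ((fun u => G.neighborSet u \ U) '' U).ncard

namespace Triple

/-- The vertex set of the two-row graph on the columns in `Q`. -/
def twoRows (Q : Finset ℕ) : Set (ℕ × ℕ) := {p | p.1 ∈ Q ∧ (p.2 = 0 ∨ p.2 = 1)}

/-- The two-row graph on the columns in `Q`. -/
def twoRowGraph (δ : Triple) (Q : Finset ℕ) : SimpleGraph (twoRows Q) :=
  δ.grid.induce (twoRows Q)

/-- `𝒩^δ(Q)`: the number of neighbourhood types of the first row in the two-row graph. -/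
noncomputable def N (δ : Triple) (Q : Finset ℕ) : ℕ :=
  mu (δ.twoRowGraph Q) {v | v.1.2 = 0}

/-- The bond-graph on `Q`. -/
def bondGraph (δ : Triple) (Q : Finset ℕ) : SimpleGraph Q where
  Adj x y := ((x : ℕ), (y : ℕ)) ∈ δ.β
  symm := ⟨fun _ _ h => δ.β_symm _ _ h⟩
  loopless := ⟨fun x h => by simpa using δ.β_dist _ _ h⟩

/-- `ℳ^β(n)`: the supremum over `1 ≤ m < n` of the number of neighbourhood types of the first
`m` columns in the bond-graph on the first `n` columns. -/
noncomputable def M (δ : Triple) (n : ℕ) : ℕ :=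
  (Finset.Ico 1 n).sup fun m => mu (δ.bondGraph (Finset.range n)) {x | (x : ℕ) < m}

/-- The bond-set has bounded `ℳ^β`. -/
def BoundedM (δ : Triple) : Prop := ∃ B : ℕ, ∀ n, 2 ≤ n → δ.M n < B

/-- With `δ*` the factor on the `k` columns starting at `j`: `copyEnd 0 = 0`, and `copyEnd (i + 1)`
is the least `t > copyEnd i + k` such that the columns `t - k, …, t - 1` carry a copy of `δ*`.
(For recurrent `δ` and `k ≥ 2` such a `t` always exists.) -/
noncomputable def copyEnd (δ : Triple) (j k : ℕ) : ℕ → ℕ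
  | 0 => 0
  | i + 1 => sInf {t : ℕ | copyEnd δ j k i + k < t ∧ δ.SameFactor k j (t - k)}

/-- The columns of the successive `δ*`-gaps: the initial columns up to the end of the first copy;
then, for each copy, all columns from its start to the end of the next copy. -/
noncomputable def gap (δ : Triple) (j k : ℕ) : ℕ → Finset ℕ
  | 0 => Finset.Ico 0 (δ.copyEnd j k 1)
  | i + 1 => Finset.Ico (δ.copyEnd j k (i + 1) - k) (δ.copyEnd j k (i + 2))

/-- `𝒩^δ_*(n)` for the factor on the `k` columns starting at `j`: the supremum of `𝒩^δ` over the
first `n` gaps. -/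
noncomputable def gapN (δ : Triple) (j k n : ℕ) : ℕ :=
  (Finset.range n).sup fun i => δ.N (δ.gap j k i)

/-- `𝒩^δ_*` is bounded for the factor on the `k` columns starting at `j`. -/
def BoundedGapN (δ : Triple) (j k : ℕ) : Prop := ∃ B : ℕ, ∀ n, δ.gapN j k n ≤ B

/-- `Δ`: the triples whose graph class has unbounded clique-width. -/
def Delta : Set Triple := {δ | ¬ δ.graphClass.BoundedCwd}

/-- `Δ_min`: the recurrent triples in `Δ` with bounded `ℳ^β` and with bounded `𝒩^δ_*` for every
factor. -/
def DeltaMin : Set Triple :=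
  {δ | δ ∈ Delta ∧ δ.IsRecurrent ∧ (∀ k, 2 ≤ k → ∀ j, δ.BoundedGapN j k) ∧ δ.BoundedM}

end Triple

end GridClass

/-!
The class `δ.graphClass` is hereditary by definition, it has unbounded clique-width because `δ ∈ Δ`,
and linear clique-width is at least clique-width. So it remains to bound the linear clique-width of
a hereditary class `D` that omits some graph `H` of `δ.graphClass`.

A graph has small linear clique-width once its vertices can be ordered so that, for every cut of
the ordering, the lower part has few types, that is, few classes under having the same neighbours in
the upper part (`lcw_le_of_key`). Such an ordering is found for every `G ∈ D`, embedded in the grid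
as a set `S` of vertices.

The omitted graph `H` lies in the first `K` columns and the first `h` rows, and by recurrence the
factor on the first `K` columns has copies arbitrarily far to the right. In each copy `S` is cut
into a left and a right part with few types across the cut. To this end the columns of the copy are
divided into runs, linked by the letters `0` and `1` inside a run and by `2` and `3` between runs.
Consider intervals of rows that contain, for every run, a row all of whose vertices in this run are
in `S`. If there are `h(K+1)` successive ones, paths that stay in one row during a run and go down
to the preceding interval between runs give a copy of `H` in `S`
(`Triple.exists_embedding_of_blocks`), which is impossible. Otherwise the rows are divided into
boundedly many strips, each of which is a single row or contains no full row for some run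
(`exists_blocks_or_strips`). In the latter case every row of the strip is cut at a vertex of this
run that is missing from `S`; then, within the strip, only letters `0` and `1` link the two sides,
and only at distinct rows, so that adjacency across the cut depends on the columns alone. Between
different strips it depends only on the columns and on the order of the strips
(`Triple.exists_cut_of_strips`).

The vertices are ordered by gaps, from the cut in one copy to the cut in the next one, and inside a
gap row by row, from left to right (`Triple.homog_of_gaps`). The types across a cut of this ordering
come from the cuts in the two copies, from the lower rows of the gap facing its higher rows, which
`𝒩^δ` of the gap bounds (`Triple.homog_of_rows`), and from bonds between the columns on the left and
on the right of some column, which `ℳ^β` bounds (`Triple.homog_of_bonds`).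
-/

namespace GridClass

/-! ### Counting types across a cut -/

/-- The vertices of `X` fall into at most `b` classes, any two vertices of a class having the same
neighbours in `Y`. The classes are named by the natural numbers below `b`. -/
def Homog {V : Type*} (G : SimpleGraph V) (X Y : Set V) (b : ℕ) : Prop :=
  ∃ τ : V → ℕ, (∀ x ∈ X, τ x < b) ∧
    ∀ x ∈ X, ∀ x' ∈ X, τ x = τ x' → ∀ y ∈ Y, (G.Adj x y ↔ G.Adj x' y)

namespace Homog

variable {V : Type*} {G : SimpleGraph V} {X X₁ X₂ Y Y₁ Y₂ : Set V} {b b₁ b₂ : ℕ}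

theorem mono (h : Homog G X Y b) (hX : X₁ ⊆ X) (hY : Y₁ ⊆ Y) (hb : b ≤ b₁) :
    Homog G X₁ Y₁ b₁ := by
  obtain ⟨τ, h1, h2⟩ := h
  exact ⟨τ, fun x hx => (h1 x (hX hx)).trans_le hb,
    fun x hx x' hx' e y hy => h2 x (hX hx) x' (hX hx') e y (hY hy)⟩

theorem of_image {T : Type*} (F : V → T) (s : Set T) (hs : s.Finite) (hb : s.ncard ≤ b)
    (hF : ∀ x ∈ X, F x ∈ s)
    (h : ∀ x ∈ X, ∀ x' ∈ X, F x = F x' → ∀ y ∈ Y, (G.Adj x y ↔ G.Adj x' y)) :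
    Homog G X Y b := by
  classical
  have := hs.to_subtype
  have e : s ≃ Fin s.ncard := Finite.equivFin s
  refine ⟨fun x => if hx : F x ∈ s then e ⟨F x, hx⟩ else 0, fun x hx => ?_,
    fun x hx x' hx' hxx => h x hx x' hx' ?_⟩
  · simp only [hF x hx, dif_pos]
    exact (e _).2.trans_le hb
  · simp only [hF x hx, hF x' hx', dif_pos] at hxx
    simpa using e.injective (Fin.ext hxx)

theorem union_left (h₁ : Homog G X₁ Y b₁) (h₂ : Homog G X₂ Y b₂) :
    Homog G (X₁ ∪ X₂) Y (b₁ + b₂) := by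
  classical
  obtain ⟨τ, h1, h2⟩ := h₁
  obtain ⟨σ, h3, h4⟩ := h₂
  refine ⟨fun x => if x ∈ X₁ then τ x else b₁ + σ x, fun x hx => ?_, fun x hx x' hx' e => ?_⟩
  · by_cases h : x ∈ X₁
    · have := h1 x h
      simp only [h, if_true]
      omega
    · have := h3 x (hx.resolve_left h)
      simp only [h, if_false]
      omega
  · by_cases h : x ∈ X₁ <;> by_cases h' : x' ∈ X₁ <;> simp only [h, h', if_true, if_false] at e
    · exact h2 x h x' h' e
    · have := h1 x h
      omega
    · have := h1 x' h'
      omega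
    · exact h4 x (hx.resolve_left h) x' (hx'.resolve_left h') (by omega)

theorem union_right (h₁ : Homog G X Y₁ b₁) (h₂ : Homog G X Y₂ b₂) :
    Homog G X (Y₁ ∪ Y₂) (b₁ * b₂) := by
  obtain ⟨τ, h1, h2⟩ := h₁
  obtain ⟨σ, h3, h4⟩ := h₂
  refine of_image (fun x => (τ x, σ x)) (Set.Iio b₁ ×ˢ Set.Iio b₂)
    ((Set.finite_Iio b₁).prod (Set.finite_Iio b₂)) (by simp [Set.ncard_prod])
    (fun x hx => ⟨h1 x hx, h3 x hx⟩) fun x hx x' hx' e y hy => ?_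
  obtain ⟨e1, e2⟩ := Prod.mk.inj e
  exact hy.elim (h2 x hx x' hx' e1 y) (h4 x hx x' hx' e2 y)

theorem singleton (v : V) : Homog G {v} Y 1 :=
  ⟨fun _ => 0, by simp, fun x hx x' hx' _ y _ => by
    rw [Set.mem_singleton_iff.1 hx, Set.mem_singleton_iff.1 hx']⟩

theorem comap {W : Type*} {H : SimpleGraph W} (f : H ↪g G) {A B : Set W}
    (h : Homog G X Y b) (hA : ∀ a ∈ A, f a ∈ X) (hB : ∀ a ∈ B, f a ∈ Y) : Homog H A B b := by
  obtain ⟨τ, h1, h2⟩ := h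
  refine ⟨fun a => τ (f a), fun a ha => h1 _ (hA a ha), fun a ha a' ha' e c hc => ?_⟩
  rw [← f.map_adj_iff, ← f.map_adj_iff (v := a')]
  exact h2 _ (hA a ha) _ (hA a' ha') e _ (hB c hc)

end Homog

/-! ### Linear clique-width from a vertex ordering -/

/-- Some linear expression builds the subgraph of `H` induced on `A`, with labels given
by `lab`. -/
def Builds {V : Type} (k : ℕ) (A : Set V) (H : SimpleGraph V) (lab : V → Fin k) : Prop :=
  ∃ e : CWExpr k, e.IsLinear ∧ ∃ f : e.Vert → V, Function.Injective f ∧ Set.range f = A ∧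
    (∀ x y, e.graph.Adj x y ↔ H.Adj (f x) (f y)) ∧ ∀ x, e.label x = lab (f x)

namespace Builds

variable {V : Type} {k : ℕ} {A : Set V} {H H' : SimpleGraph V} {lab lab' : V → Fin k}

theorem congr (h : Builds k A H lab) (hH : ∀ x ∈ A, ∀ y ∈ A, (H.Adj x y ↔ H'.Adj x y))
    (hl : ∀ x ∈ A, lab x = lab' x) : Builds k A H' lab' := by
  obtain ⟨e, he, f, hf, rfl, hadj, hlab⟩ := h
  exact ⟨e, he, f, hf, rfl, fun x y => (hadj x y).trans (hH _ ⟨x, rfl⟩ _ ⟨y, rfl⟩),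
    fun x => (hlab x).trans (hl _ ⟨x, rfl⟩)⟩

theorem single (v : V) : Builds k {v} H lab := by
  refine ⟨.vertex (lab v), trivial, fun _ => v, fun (_ : Unit) (_ : Unit) _ => rfl, ?_,
    fun x y => ?_, fun x => rfl⟩
  · have : Nonempty (CWExpr.vertex (lab v)).Vert := ⟨()⟩
    exact Set.range_const
  · exact iff_of_false (fun h => h) (H.irrefl)

theorem add_vertex (h : Builds k A H lab) {v : V} (hv : v ∉ A) (hAv : ∀ u ∈ A, ¬ H.Adj u v) :
    Builds k (insert v A) H lab := by
  obtain ⟨e, he, f, hf, rfl, hadj, hlab⟩ := h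
  refine ⟨.union e (.vertex (lab v)), ⟨he, _, rfl⟩, Sum.elim f (fun _ => v), ?_, ?_, ?_, ?_⟩
  · rintro (x | x) (y | y) hxy
    · exact congrArg _ (hf hxy)
    · exact (hv ⟨x, hxy⟩).elim
    · exact (hv ⟨y, hxy.symm⟩).elim
    · rfl
  · ext w
    constructor
    · rintro ⟨x | x, rfl⟩
      · exact Or.inr ⟨x, rfl⟩
      · exact Or.inl rfl
    · rintro (rfl | ⟨x, rfl⟩)
      · exact ⟨Sum.inr (), rfl⟩
      · exact ⟨Sum.inl x, rfl⟩
  · rintro (x | x) (y | y)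
    · exact hadj x y
    · exact iff_of_false (by rintro ⟨⟩) (hAv _ ⟨x, rfl⟩)
    · exact iff_of_false (by rintro ⟨⟩) fun h => hAv _ ⟨y, rfl⟩ h.symm
    · exact iff_of_false (fun h => h) H.irrefl
  · rintro (x | x)
    · exact hlab x
    · rfl

theorem join (h : Builds k A H lab) {i j : Fin k} (hij : i ≠ j) :
    Builds k A (H ⊔ SimpleGraph.fromRel (fun u v => lab u = i ∧ lab v = j)) lab := by
  obtain ⟨e, he, f, hf, rfl, hadj, hlab⟩ := h
  refine ⟨.join i j hij e, he, f, hf, rfl, fun (x y : e.Vert) => ?_, hlab⟩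
  change (e.graph ⊔ SimpleGraph.fromRel (fun u v => e.label u = i ∧ e.label v = j)).Adj x y ↔ _
  simp only [SimpleGraph.sup_adj, SimpleGraph.fromRel_adj, hadj, hlab, hf.ne_iff]

theorem relabel (h : Builds k A H lab) (i j : Fin k) :
    Builds k A H (fun v => if lab v = i then j else lab v) := by
  obtain ⟨e, he, f, hf, rfl, hadj, hlab⟩ := h
  refine ⟨.relabel i j e, he, f, hf, rfl, hadj, fun (x : e.Vert) => ?_⟩
  change (if e.label x = i then j else e.label x) = _
  rw [hlab]

/-- All vertices with a label in `P` can be joined to all vertices labelled `i`. -/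
theorem join_finset (h : Builds k A H lab) (i : Fin k) (P : Finset (Fin k)) (hP : i ∉ P) :
    Builds k A (H ⊔ SimpleGraph.fromRel (fun u v => lab u ∈ P ∧ lab v = i)) lab := by
  classical
  induction P using Finset.induction_on with
  | empty => exact h.congr (fun x _ y _ => by simp) fun _ _ => rfl
  | insert a P _ ih =>
    rw [Finset.mem_insert, not_or] at hP
    refine ((ih hP.2).join (i := a) (j := i) (Ne.symm hP.1)).congr (fun x _ y _ => ?_)
      fun _ _ => rfl
    simp only [SimpleGraph.sup_adj, SimpleGraph.fromRel_adj, Finset.mem_insert]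
    tauto

/-- The labels in `Q` can be changed along any map that sends them outside `Q`: the relabellings
can then be made one after the other without interfering. -/
theorem relabel_finset (h : Builds k A H lab) (Q : Finset (Fin k)) (g : Fin k → Fin k)
    (hg : ∀ i ∈ Q, g i ∉ Q) :
    ∃ lab', Builds k A H lab' ∧ ∀ x, lab x ∈ Q → lab' x = g (lab x) := by
  classical
  suffices key : ∀ P ⊆ Q, Builds k A H (fun v => if lab v ∈ P then g (lab v) else lab v) from
    ⟨_, key Q subset_rfl, fun x hx => if_pos hx⟩
  intro P
  induction P using Finset.induction_on with
  | empty => exact fun _ => h.congr (fun _ _ _ _ => Iff.rfl) fun x _ => by simp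
  | insert a P haP ih =>
    intro hPQ
    refine ((ih ((Finset.subset_insert a P).trans hPQ)).relabel a (g a)).congr
      (fun _ _ _ _ => Iff.rfl) fun x _ => ?_
    have haQ := hPQ (Finset.mem_insert_self a P)
    by_cases hx : lab x ∈ P
    · have hne : g (lab x) ≠ a := fun h =>
        hg _ (hPQ (Finset.mem_insert_of_mem hx)) (h ▸ haQ)
      simp [hx, hne]
    · by_cases hxa : lab x = a
      · simp [hxa, haP]
      · simp [hx, hxa]

end Builds

/-- One step along the ordering. The labels `0, …, b - 1` carry the classes of the old vertices,
the label `2b` is reserved for the new vertex, and `b, …, 2b - 1` are intermediate labels, so that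
the old classes can be renamed without being mixed up. -/
theorem Builds.step {V : Type} {G : SimpleGraph V} {A : Set V} {b : ℕ} {v : V}
    {lab : V → Fin (2 * b + 1)} (h : Builds (2 * b + 1) A G lab) (hlt : ∀ x ∈ A, (lab x : ℕ) < b)
    (hlab : ∀ x ∈ A, ∀ x' ∈ A, lab x = lab x' → ∀ y ∉ A, (G.Adj x y ↔ G.Adj x' y))
    (hv : v ∉ A) (hom : Homog G (insert v A) (insert v A)ᶜ b) :
    ∃ lab' : V → Fin (2 * b + 1), Builds (2 * b + 1) (insert v A) G lab' ∧
      (∀ x ∈ insert v A, (lab' x : ℕ) < b) ∧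
      ∀ x ∈ insert v A, ∀ x' ∈ insert v A, lab' x = lab' x' → ∀ y ∉ insert v A,
        (G.Adj x y ↔ G.Adj x' y) := by
  classical
  obtain ⟨τ, hτ, hom⟩ := hom
  set ℓ : Fin (2 * b + 1) := Fin.last _ with hℓ
  have hℓv : (ℓ : ℕ) = 2 * b := rfl
  -- a representative of each label class
  obtain ⟨rep, hrep⟩ : ∃ rep : Fin (2 * b + 1) → V,
      ∀ x ∈ A, rep (lab x) ∈ A ∧ lab (rep (lab x)) = lab x := by
    have : ∀ i, ∃ w, ∀ x ∈ A, lab x = i → w ∈ A ∧ lab w = i := fun i => by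
      by_cases hi : ∃ x ∈ A, lab x = i
      · obtain ⟨x, hx⟩ := hi
        exact ⟨x, fun _ _ _ => hx⟩
      · exact ⟨v, fun x hx e => (hi ⟨x, hx, e⟩).elim⟩
    choose rep hrep using this
    exact ⟨rep, fun x hx => hrep _ x hx rfl⟩
  have hne : ∀ x ∈ A, lab x ≠ ℓ := fun x hx e => by
    have := hlt x hx
    rw [e, hℓv] at this
    omega
  have hxv : ∀ x ∈ A, x ≠ v := fun x hx e => hv (e ▸ hx)
  -- the new vertex, isolated and labelled `ℓ`
  set H₀ : SimpleGraph V := SimpleGraph.fromRel (fun x y => G.Adj x y ∧ x ≠ v ∧ y ≠ v) with hH₀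
  set lab₁ : V → Fin (2 * b + 1) := fun x => if x = v then ℓ else lab x with hlab₁
  have s1 : Builds (2 * b + 1) (insert v A) H₀ lab₁ := by
    refine (h.congr (fun x hx y hy => ?_) fun x hx => ?_).add_vertex hv fun u _ => ?_
    · have := hxv x hx
      have := hxv y hy
      simp only [hH₀, SimpleGraph.fromRel_adj, G.adj_comm y x]
      have : G.Adj x y → x ≠ y := fun h => h.ne
      tauto
    · simp [hlab₁, hxv x hx]
    · simp [hH₀]
  -- its edges
  set P : Finset (Fin (2 * b + 1)) := Finset.univ.filter fun i => ∃ x ∈ A, lab x = i ∧ G.Adj x v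
    with hP
  have hℓP : ℓ ∉ P := by
    simp only [hP, Finset.mem_filter, Finset.mem_univ, true_and, not_exists, not_and]
    exact fun x hx e => (hne x hx e).elim
  have hmemP : ∀ x ∈ A, (lab x ∈ P ↔ G.Adj x v) := fun x hx => by
    simp only [hP, Finset.mem_filter, Finset.mem_univ, true_and]
    exact ⟨fun ⟨y, hy, e, hyv⟩ => (hlab y hy x hx e v hv).1 hyv, fun h => ⟨x, hx, rfl, h⟩⟩
  have s2 : Builds (2 * b + 1) (insert v A) G lab₁ := by
    refine (s1.join_finset ℓ P hℓP).congr (fun x hx y hy => ?_) fun _ _ => rfl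
    simp only [SimpleGraph.sup_adj, SimpleGraph.fromRel_adj, hH₀, hlab₁]
    rcases hx with rfl | hx <;> rcases hy with rfl | hy
    · simp
    · simp [hxv y hy, (hxv y hy).symm, hne y hy, hℓP, hmemP y hy, G.adj_comm]
    · simp [hxv x hx, hne x hx, hℓP, hmemP x hx]
    · simp only [hxv x hx, hxv y hy, if_false, hne x hx, hne y hy, G.adj_comm y x]
      have : G.Adj x y → x ≠ y := fun h => h.ne
      tauto
  -- the new classes, first named by labels in `b, …, 2b - 1`, then by labels below `b`
  set rp : Fin (2 * b + 1) → V := fun i => if i = ℓ then v else rep i with hrp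
  have hb : 0 < b := (Nat.zero_le _).trans_lt (hτ v (Set.mem_insert v A))
  have hrpA : ∀ x ∈ insert v A, rp (lab₁ x) ∈ insert v A ∧ (lab₁ x < b ∨ lab₁ x = ℓ) ∧
      ∀ y ∉ insert v A, (G.Adj x y ↔ G.Adj (rp (lab₁ x)) y) := by
    rintro x (rfl | hx)
    · simp [hrp, hlab₁]
    · have h1 : lab₁ x = lab x := by simp [hlab₁, hxv x hx]
      have h2 : rp (lab x) = rep (lab x) := by simp [hrp, hne x hx]
      rw [h1, h2]
      exact ⟨Or.inr (hrep x hx).1, Or.inl (hlt x hx), fun y hy =>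
        hlab _ hx _ (hrep x hx).1 (hrep x hx).2.symm y fun h => hy (Or.inr h)⟩
  set g : Fin (2 * b + 1) → Fin (2 * b + 1) :=
    fun i => ⟨min (b + τ (rp i)) (2 * b - 1), by omega⟩ with hg
  obtain ⟨lab₂, s3, hlab₂⟩ := s2.relabel_finset
    (Finset.univ.filter fun i => (i : ℕ) < b ∨ i = ℓ) g (by
    intro i _
    simp only [hg, Finset.mem_filter, Finset.mem_univ, true_and, Fin.ext_iff, hℓv]
    omega)
  obtain ⟨lab₃, s4, hlab₃⟩ := s3.relabel_finset
    (Finset.univ.filter fun i => b ≤ (i : ℕ) ∧ (i : ℕ) < 2 * b)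
    (fun i => ⟨i - b, by omega⟩) (by
    intro i
    simp only [Finset.mem_filter, Finset.mem_univ, true_and]
    omega)
  have hval : ∀ x ∈ insert v A, (lab₃ x : ℕ) = τ (rp (lab₁ x)) := fun x hx => by
    obtain ⟨h1, h2, -⟩ := hrpA x hx
    have h3 := hτ _ h1
    have h4 : (lab₂ x : ℕ) = b + τ (rp (lab₁ x)) := by
      rw [hlab₂ x (by simpa using h2)]
      simp only [hg]
      omega
    rw [hlab₃ x (by simp only [Finset.mem_filter, Finset.mem_univ, true_and]; omega)]
    simp only [h4]
    omega
  refine ⟨lab₃, s4, fun x hx => (hval x hx).trans_lt (hτ _ (hrpA x hx).1),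
    fun x hx x' hx' e y hy => ?_⟩
  rw [(hrpA x hx).2.2 y hy, (hrpA x' hx').2.2 y hy]
  exact hom _ (hrpA x hx).1 _ (hrpA x' hx').1
    (by rw [← hval x hx, ← hval x' hx', e]) y hy

theorem CWExpr.nonempty_vert {k : ℕ} (e : CWExpr k) : Nonempty e.Vert := by
  induction e with
  | vertex => exact ⟨()⟩
  | join _ _ _ _ ih => exact ih
  | relabel _ _ _ ih => exact ih
  | union _ _ ih _ => exact ih.map Sum.inl

/-- If every cut of a linear ordering of the vertices splits its lower part into at most `b` types,
then `2b + 1` labels suffice for a linear expression: the graph is built vertex by vertex along the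
ordering, the labels recording the types. -/
theorem exists_isLinear_of_key {V : Type} [Finite V] [Nonempty V] (G : SimpleGraph V)
    {T : Type*} [LinearOrder T] (key : V → T) (hkey : Function.Injective key) (b : ℕ)
    (h : ∀ v, Homog G {u | key u ≤ key v} {u | key v < key u} b) :
    ∃ e : CWExpr (2 * b + 1), e.IsLinear ∧ Nonempty (e.graph ≃g G) := by
  classical
  have := Fintype.ofFinite V
  suffices key : ∀ s : Finset V, (∀ x ∈ s, ∀ u, key u ≤ key x → u ∈ s) → s.Nonempty →
      ∃ lab : V → Fin (2 * b + 1), Builds (2 * b + 1) (s : Set V) G lab ∧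
        (∀ x ∈ (s : Set V), (lab x : ℕ) < b) ∧ ∀ x ∈ (s : Set V), ∀ x' ∈ (s : Set V),
          lab x = lab x' → ∀ y ∉ (s : Set V), (G.Adj x y ↔ G.Adj x' y) by
    obtain ⟨lab, ⟨e, he, f, hf, hr, hadj, -⟩, -⟩ :=
      key Finset.univ (fun _ _ _ _ => Finset.mem_univ _) Finset.univ_nonempty
    refine ⟨e, he, ⟨⟨Equiv.ofBijective f ⟨hf, fun v => ?_⟩, ?_⟩⟩⟩
    · have : v ∈ Set.range f := by simp [hr]
      exact this
    · exact fun {x y} => (hadj x y).symm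
  intro s
  induction s using Finset.induction_on_max_value key with
  | empty => exact fun _ h => (Finset.not_nonempty_empty h).elim
  | insert a s has hmax ih =>
    intro hdown _
    have hle : ∀ u, u ∈ insert a s ↔ key u ≤ key a := fun u =>
      ⟨fun hu => (Finset.mem_insert.1 hu).elim (fun e => e ▸ le_rfl) (hmax u),
        hdown a (Finset.mem_insert_self a s) u⟩
    have hom : Homog G (insert a (s : Set V)) (insert a (s : Set V))ᶜ b := by
      refine (h a).mono (fun u hu => (hle u).1 (by simpa using hu)) (fun u hu => ?_) le_rfl
      exact lt_of_not_ge fun hua => hu (by simpa using (hle u).2 hua)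
    rw [Finset.coe_insert]
    rcases s.eq_empty_or_nonempty with rfl | hs
    · obtain ⟨τ, hτ, -⟩ := hom
      have hb : 0 < b := (Nat.zero_le _).trans_lt (hτ a (Set.mem_insert a _))
      refine ⟨fun _ => 0, by simpa using Builds.single a, fun _ _ => hb, ?_⟩
      intro x hx x' hx' _ y _
      have h1 : x = a := by simpa using hx
      have h2 : x' = a := by simpa using hx'
      rw [h1, h2]
    · obtain ⟨lab, hB, hlt, hlab⟩ := ih (fun x hx u hu => by
        refine Finset.mem_of_mem_insert_of_ne (hdown x (Finset.mem_insert_of_mem hx) u hu) ?_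
        rintro rfl
        exact has (hkey (le_antisymm hu (hmax x hx)) ▸ hx)) hs
      exact hB.step hlt hlab has hom

theorem setOf_isLinear_eq_empty {V : Type} [IsEmpty V] (G : SimpleGraph V) :
    {k : ℕ | ∃ e : CWExpr k, e.IsLinear ∧ Nonempty (e.graph ≃g G)} = ∅ :=
  Set.eq_empty_of_forall_notMem fun _ ⟨e, _, ⟨φ⟩⟩ => isEmptyElim (φ e.nonempty_vert.some)

theorem lcw_le_of_key {V : Type} [Finite V] (G : SimpleGraph V) {T : Type*} [LinearOrder T]
    (key : V → T) (hkey : Function.Injective key) (b : ℕ)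
    (h : ∀ v, Homog G {u | key u ≤ key v} {u | key v < key u} b) : lcw G ≤ 2 * b + 1 := by
  rcases isEmpty_or_nonempty V with hV | hV
  · simp [lcw, setOf_isLinear_eq_empty]
  · exact Nat.sInf_le (exists_isLinear_of_key G key hkey b h)

theorem cwd_le_lcw {V : Type} [Finite V] (G : SimpleGraph V) : cwd G ≤ lcw G := by
  rcases isEmpty_or_nonempty V with hV | hV
  · have hemp : {k : ℕ | ∃ e : CWExpr k, Nonempty (e.graph ≃g G)} = ∅ :=
      Set.eq_empty_of_forall_notMem fun _ ⟨e, ⟨φ⟩⟩ => isEmptyElim (φ e.nonempty_vert.some)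
    simp [cwd, hemp]
  · -- a graph on `n` vertices has at most `n` types across any cut, so `lcw` is not a junk value
    have ex : {k : ℕ | ∃ e : CWExpr k, e.IsLinear ∧ Nonempty (e.graph ≃g G)}.Nonempty :=
      ⟨_, exists_isLinear_of_key G (Finite.equivFin V) (Finite.equivFin V).injective (Nat.card V)
        fun v => ⟨fun u => Finite.equivFin V u, fun u _ => (Finite.equivFin V u).2,
          fun u _ u' _ e y _ => by rw [(Finite.equivFin V).injective (Fin.ext e)]⟩⟩
    obtain ⟨e, _, hφ⟩ := Nat.sInf_mem ex
    exact Nat.sInf_le ⟨e, hφ⟩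

/-! ### Types in the grid graph -/

namespace Triple

/-- Rows matter for adjacency only through the links between consecutive columns and through
equality within a column. -/
theorem grid_adj_congr (δ : Triple) {i i' j j₁ l l₁ : ℕ}
    (hr : i' = i + 1 → (linkAdj (δ.α i) j l ↔ linkAdj (δ.α i) j₁ l₁))
    (hl : i = i' + 1 → (linkAdj (δ.α i') l j ↔ linkAdj (δ.α i') l₁ j₁))
    (hs : i = i' → (j = l ↔ j₁ = l₁)) :
    δ.grid.Adj (i, j) (i', l) ↔ δ.grid.Adj (i, j₁) (i', l₁) := by
  simp only [grid, ne_eq]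
  tauto

theorem linkAdj_lt {a : Fin 4} {j l : ℕ} (h : j < l) : linkAdj a j l ↔ a = 1 ∨ a = 3 := by
  simp only [linkAdj]
  constructor
  · rintro (h | h | h | h)
    all_goals omega
  · rintro (h | h) <;> simp [h] <;> omega

theorem linkAdj_gt {a : Fin 4} {j l : ℕ} (h : l < j) : linkAdj a j l ↔ a = 1 ∨ a = 2 := by
  simp only [linkAdj]
  constructor
  · rintro (h | h | h | h)
    all_goals omega
  · rintro (h | h) <;> simp [h] <;> omega

theorem linkAdj_ne {a : Fin 4} (ha : ¬ 2 ≤ a) {j l : ℕ} (h : j ≠ l) :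
    linkAdj a j l ↔ a = 1 := by
  have h2 : a ≠ 2 := fun e => ha e.ge
  have h3 : a ≠ 3 := fun e => ha (by rw [e]; decide)
  simp only [linkAdj, h2, h3, h, ne_eq, not_false_eq_true, and_false, and_true, false_and,
    false_or, or_false]

theorem grid_adj_congr_of_lt (δ : Triple) {i i' j j₁ l l₁ : ℕ} (h : j < l) (h₁ : j₁ < l₁) :
    δ.grid.Adj (i, j) (i', l) ↔ δ.grid.Adj (i, j₁) (i', l₁) :=
  δ.grid_adj_congr (fun _ => (linkAdj_lt h).trans (linkAdj_lt h₁).symm)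
    (fun _ => (linkAdj_gt h).trans (linkAdj_gt h₁).symm) fun _ => iff_of_false h.ne h₁.ne

/-- Across a cut between two sets of columns with no links, only bonds count. -/
theorem homog_of_bonds (δ : Triple) {B : ℕ} (hB : ∀ n, 2 ≤ n → δ.M n < B) {X Y : Set (ℕ × ℕ)}
    (m n : ℕ) (hX : ∀ x ∈ X, x.1 < m) (hY : ∀ y ∈ Y, m ≤ y.1 ∧ y.1 < n)
    (hXY : ∀ x ∈ X, ∀ y ∈ Y, y.1 ≠ x.1 + 1) : Homog δ.grid X Y B := by
  by_cases hne : 1 ≤ m ∧ m < n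
  swap
  · refine ⟨fun _ => 0, fun _ _ => (Nat.zero_le _).trans_lt (hB 2 le_rfl),
      fun x hx x' _ _ y hy => ?_⟩
    have := hX x hx
    have := hY y hy
    omega
  set U : Set (Finset.range n) := {x | (x : ℕ) < m}
  have hadj : ∀ x ∈ X, ∀ y ∈ Y, (δ.grid.Adj x y ↔ (x.1, y.1) ∈ δ.β) := fun x hx y hy => by
    have := hX x hx
    have := hY y hy
    have := hXY x hx y hy
    simp only [grid]
    constructor
    · rintro (h | h | h | h)
      · omega
      · omega
      · exact h
      · omega
    · tauto
  refine Homog.of_image (fun x => ({y | (x.1, (y : ℕ)) ∈ δ.β ∧ m ≤ y} : Set (Finset.range n)))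
    ((fun u => (δ.bondGraph (Finset.range n)).neighborSet u \ U) '' U) (Set.toFinite _)
    ?_ (fun x hx => ?_) fun x hx x' hx' e y hy => ?_
  · refine le_trans ?_ (hB n (by omega)).le
    exact Finset.le_sup (f := fun m => mu (δ.bondGraph (Finset.range n)) {x | (x : ℕ) < m})
      (Finset.mem_Ico.2 hne)
  · have := hX x hx
    refine ⟨⟨x.1, by simp; omega⟩, this, ?_⟩
    ext y
    simp [bondGraph, U]
  · rw [hadj x hx y hy, hadj x' hx' y hy]
    have := hY y hy
    have h := Set.ext_iff.1 e ⟨y.1, by simp; omega⟩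
    simpa [this.1] using h

/-- The lower rows of a set of columns look at its higher rows as the first row looks at
the second. -/
theorem homog_of_rows (δ : Triple) (Q : Finset ℕ) {X Y : Set (ℕ × ℕ)} (hX : ∀ x ∈ X, x.1 ∈ Q)
    (hY : ∀ y ∈ Y, y.1 ∈ Q) (hXY : ∀ x ∈ X, ∀ y ∈ Y, x.2 < y.2) :
    Homog δ.grid X Y (δ.N Q) := by
  have hfin : (twoRows Q).Finite := by
    refine (Q.finite_toSet.prod (Set.finite_Iio 2)).subset fun p hp => ⟨hp.1, ?_⟩
    have := hp.2
    simp only [Set.mem_Iio]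
    omega
  have := hfin.to_subtype
  refine Homog.of_image
    (fun x => ({y | δ.grid.Adj (x.1, 0) y.1 ∧ y.1.2 ≠ 0} : Set (twoRows Q)))
    ((fun u => (δ.twoRowGraph Q).neighborSet u \ {v | v.1.2 = 0}) '' {v | v.1.2 = 0})
    (Set.toFinite _) le_rfl (fun x hx => ?_) fun x hx x' hx' e y hy => ?_
  · refine ⟨⟨(x.1, 0), hX x hx, Or.inl rfl⟩, rfl, ?_⟩
    ext y
    simp [twoRowGraph]
  · have h := Set.ext_iff.1 e ⟨(y.1, 1), hY y hy, Or.inr rfl⟩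
    simp only [Set.mem_ofPred_eq, ne_eq, one_ne_zero, not_false_eq_true, and_true] at h
    exact (δ.grid_adj_congr_of_lt (hXY x hx y hy) one_pos).trans
      (h.trans (δ.grid_adj_congr_of_lt one_pos (hXY x' hx' y hy)))

end Triple

/-! ### Rows that are full on a run of columns -/

/-- For a property `full u j` of rows `j`, with `u < K`: either there are `n` successive blocks of
rows, each of which has for every `u` a row that is full for `u`, or the rows are divided into at
most `2n + 1` consecutive strips, each of which is a single row or has no full row for some `u`. -/
theorem exists_blocks_or_strips (K : ℕ) (full : ℕ → ℕ → Prop) (n : ℕ) : ∀ a : ℕ,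
    (∃ ρ : ℕ → ℕ → ℕ, (∀ t < n, ∀ u < K, a ≤ ρ t u ∧ full u (ρ t u)) ∧
      ∀ t t', t < t' → t' < n → ∀ u < K, ∀ u' < K, ρ t u < ρ t' u') ∨
    ∃ s : ℕ → ℕ, (∀ j j', a ≤ j → j ≤ j' → s j ≤ s j') ∧ (∀ j, s j < 2 * n + 1) ∧
      ∀ j, a ≤ j → (∀ j', a ≤ j' → s j' = s j → j' = j) ∨
        ∃ u < K, ∀ j', a ≤ j' → s j' = s j → ¬ full u j' := by
  classical
  induction n with
  | zero => exact fun a => Or.inl ⟨fun _ _ => 0, by simp, by simp⟩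
  | succ n ih =>
    intro a
    by_cases hgood : ∃ b, ∀ u < K, ∃ j, a ≤ j ∧ j < b ∧ full u j
    swap
    · refine Or.inr ⟨fun _ => 0, by simp, by simp, fun j _ => Or.inr ?_⟩
      by_contra! hcon
      choose! r hr using hcon
      refine hgood ⟨(Finset.range K).sup r + 1, fun u hu => ⟨r u, (hr u hu).1, ?_, (hr u hu).2.2⟩⟩
      exact Nat.lt_succ_of_le (Finset.le_sup (f := r) (Finset.mem_range.2 hu))
    -- `[a, b)` is the shortest block starting at `a`
    obtain ⟨b, hb, hmin⟩ : ∃ b, (∀ u < K, ∃ j, a ≤ j ∧ j < b ∧ full u j) ∧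
        ∀ c < b, ¬ ∀ u < K, ∃ j, a ≤ j ∧ j < c ∧ full u j :=
      ⟨_, Nat.find_spec hgood, fun c hc => Nat.find_min hgood hc⟩
    rcases ih (max a b) with ⟨ρ, h1, h2⟩ | ⟨s, h1, h2, h3⟩
    · choose! r hr using hb
      refine Or.inl ⟨fun t => t.casesOn r ρ, ?_, ?_⟩
      · rintro (_ | t) ht u hu
        · exact ⟨(hr u hu).1, (hr u hu).2.2⟩
        · exact ⟨(le_max_left a b).trans (h1 t (by omega) u hu).1, (h1 t (by omega) u hu).2⟩
      · rintro (_ | t) (_ | t') htt ht' u hu u' hu'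
        · omega
        · exact (hr u hu).2.1.trans_le
            ((le_max_right a b).trans (h1 t' (by omega) u' hu').1)
        · omega
        · exact h2 t t' (by omega) (by omega) u hu u' hu'
    -- the rows `a, …, b - 2` are a strip, since `b` is minimal, and so is the row `b - 1`
    · refine Or.inr ⟨fun j => if j + 1 < b then 0 else if j < b then 1 else 2 + s j, ?_, ?_, ?_⟩
      · intro j j' haj hjj
        have := h1 j j'
        dsimp only
        split_ifs <;> omega
      · intro j
        have := h2 j
        dsimp only
        split_ifs <;> omega
      · intro j haj
        by_cases hj : j + 1 < b
        · have := hmin (b - 1) (by omega)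
          push Not at this
          obtain ⟨u, hu, h⟩ := this
          refine Or.inr ⟨u, hu, fun j' haj' e => h j' haj' ?_⟩
          simp only [hj, if_true] at e
          split_ifs at e <;> omega
        by_cases hj' : j < b
        · refine Or.inl fun j' haj' e => ?_
          simp only [hj, hj', if_true, if_false] at e
          split_ifs at e <;> omega
        · have key : ∀ j', a ≤ j' → (if j' + 1 < b then 0 else if j' < b then 1 else 2 + s j') =
              (if j + 1 < b then 0 else if j < b then 1 else 2 + s j) →
              max a b ≤ j' ∧ s j' = s j := fun j' haj' e => by
            simp only [hj, hj', if_false] at e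
            split_ifs at e <;> omega
          rcases h3 j (by omega) with h | ⟨u, hu, h⟩
          · exact Or.inl fun j' haj' e => h j' (key j' haj' e).1 (key j' haj' e).2
          · exact Or.inr ⟨u, hu, fun j' haj' e => h j' (key j' haj' e).1 (key j' haj' e).2⟩

namespace Triple

/-- The number of letters `2` and `3` among the first `c` letters. The columns are thereby divided
into runs, linked by letters `0` and `1` inside a run and by `2` and `3` between runs. -/
def run (δ : Triple) (c : ℕ) : ℕ := ((Finset.range c).filter fun i => 2 ≤ δ.α i).card

theorem run_succ (δ : Triple) (c : ℕ) : δ.run (c + 1) = δ.run c + if 2 ≤ δ.α c then 1 else 0 := by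
  rw [run, Finset.range_add_one, Finset.filter_insert]
  split_ifs <;> simp [run]

theorem run_mono (δ : Triple) : Monotone δ.run :=
  monotone_nat_of_le_succ fun c => by rw [run_succ]; omega

theorem run_le (δ : Triple) (c : ℕ) : δ.run c ≤ c :=
  (Finset.card_filter_le _ _).trans (Finset.card_range c).le

/-- Row `j` of `S` is full on run `u` of the copy starting at column `x`. -/
def FullRow (δ : Triple) (S : Set (ℕ × ℕ)) (K x u j : ℕ) : Prop :=
  ∀ c < K, δ.run c = u → (x + c, j) ∈ S

/-- If a copy of the first `K` columns meets `S` in `h(K+1)` successive blocks, then the first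
`h` rows of the first `K` columns embed in `S`: row `r` is sent on the first run to block
`r(K+1)+K`, and to the preceding block at each change of run. -/
theorem exists_embedding_of_blocks (δ : Triple) {S : Set (ℕ × ℕ)} {K x h : ℕ}
    (hx : δ.SameFactor K 0 x) (ρ : ℕ → ℕ → ℕ)
    (hfull : ∀ t < h * (K + 1), ∀ u < K, δ.FullRow S K x u (ρ t u))
    (hρ : ∀ t t', t < t' → t' < h * (K + 1) → ∀ u < K, ∀ u' < K, ρ t u < ρ t' u') :
    ∃ φ : ℕ × ℕ → ℕ × ℕ, ∀ p : ℕ × ℕ, p.1 < K → p.2 < h → φ p ∈ S ∧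
      ∀ q : ℕ × ℕ, q.1 < K → q.2 < h →
        (φ p = φ q → p = q) ∧ (δ.grid.Adj (φ p) (φ q) ↔ δ.grid.Adj p q) := by
  have hrun : ∀ c < K, δ.run c < K := fun c hc => (δ.run_le c).trans_lt hc
  have hidx : ∀ c r, c < K → r < h → r * (K + 1) + K - δ.run c < h * (K + 1) := fun c r _ hr => by
    have : (r + 1) * (K + 1) ≤ h * (K + 1) := Nat.mul_le_mul_right _ hr
    rw [Nat.add_mul] at this
    omega
  set σ : ℕ → ℕ → ℕ := fun c r => ρ (r * (K + 1) + K - δ.run c) (δ.run c) with hσ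
  have hlt : ∀ c c' r r', c < K → c' < K → r < h → r' < h →
      r * (K + 1) + K - δ.run c < r' * (K + 1) + K - δ.run c' → σ c r < σ c' r' :=
    fun c c' r r' hc hc' _ hr' hh => hρ _ _ hh (hidx c' r' hc' hr') _ (hrun c hc) _ (hrun c' hc')
  have hmul : ∀ {r r'}, r < r' → r * (K + 1) + (K + 1) ≤ r' * (K + 1) := fun {r r'} hr => by
    simpa [Nat.add_mul] using Nat.mul_le_mul_right (K + 1) (Nat.succ_le_of_lt hr)
  have hstrict : ∀ c c' r r', c < K → c' < K → r' < h → r < r' → σ c r < σ c' r' :=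
    fun c c' r r' hc hc' hr' hr => hlt c c' r r' hc hc' (hr.trans hr') hr' (by
      have := hmul hr
      have := hrun c hc
      have := hrun c' hc'
      omega)
  have hinj : ∀ c r r', c < K → r < h → r' < h → (σ c r = σ c r' ↔ r = r') :=
    fun c r r' hc hr hr' => by
      refine ⟨fun e => ?_, fun e => e ▸ rfl⟩
      rcases lt_trichotomy r r' with hh | hh | hh
      · exact ((hstrict c c r r' hc hc hr' hh).ne e).elim
      · exact hh
      · exact ((hstrict c c r' r hc hc hr hh).ne e.symm).elim
  have hα : ∀ c, c + 1 < K → δ.α (x + c) = δ.α c := fun c hc => by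
    simpa using (hx.1 c hc).symm
  have hlink : ∀ c r r', c + 1 < K → r < h → r' < h →
      (linkAdj (δ.α (x + c)) (σ c r) (σ (c + 1) r') ↔ linkAdj (δ.α c) r r') :=
    fun c r r' hc hr hr' => by
      rw [hα c hc]
      have hs := δ.run_succ c
      by_cases h2 : 2 ≤ δ.α c
      · -- a path goes down at a change of run, but not as far as the path below it
        rw [if_pos h2] at hs
        have hle : σ (c + 1) r' ≤ σ c r ↔ r' ≤ r := by
          constructor
          · intro hh
            by_contra hcon
            exact hh.not_gt (hstrict c (c + 1) r r' (by omega) hc hr' (by omega))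
          · intro hh
            rcases hh.eq_or_lt with rfl | hh
            · refine (hlt (c + 1) c r' r' hc (by omega) hr hr ?_).le
              have := hrun (c + 1) hc
              omega
            · exact (hstrict (c + 1) c r' r hc (by omega) hr hh).le
        have h0 : δ.α c ≠ 0 := by rintro e; simp [e] at h2
        have h1 : δ.α c ≠ 1 := by rintro e; rw [e] at h2; exact absurd h2 (by decide)
        simp only [linkAdj, h0, h1, false_and, false_or, hle, ← not_le]
      · rw [if_neg h2, add_zero] at hs
        have e : σ (c + 1) r' = σ c r' := by simp only [hσ, hs]
        have h0 : δ.α c ≠ 2 := by rintro e; simp [e] at h2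
        have h1 : δ.α c ≠ 3 := by rintro e; rw [e] at h2; exact h2 (by decide)
        simp only [linkAdj, h0, h1, false_and, or_false, e, ne_eq,
          hinj c r r' (by omega) hr hr']
  refine ⟨fun p => (x + p.1, σ p.1 p.2), ?_⟩
  rintro ⟨c, r⟩ hc hr
  refine ⟨hfull _ (hidx c r hc hr) _ (hrun c hc) c hc rfl, ?_⟩
  rintro ⟨c', r'⟩ hc' hr'
  dsimp only at hc hr hc' hr'
  constructor
  · intro e
    obtain ⟨e1, e2⟩ := Prod.mk.inj e
    obtain rfl : c = c' := by simpa using e1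
    rw [(hinj c r r' hc hr hr').1 e2]
  · have hb := hx.2.1 c c' hc hc'
    have hg := hx.2.2 c hc
    simp only [zero_add] at hb hg
    simp only [grid]
    refine or_congr ?_ (or_congr ?_ (or_congr hb.symm ?_))
    · rw [show (x + c' = x + c + 1 ↔ c' = c + 1) by omega]
      refine and_congr_right fun e => ?_
      subst e
      exact hlink c r r' hc' hr hr'
    · rw [show (x + c = x + c' + 1 ↔ c = c' + 1) by omega]
      refine and_congr_right fun e => ?_
      subst e
      exact hlink c' r' r hc hr' hr
    · rw [add_right_inj, hg]
      refine and_congr_right fun e => ?_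
      subst e
      rw [ne_eq, hinj c r r' hc hr hr']

/-- The key step: if `S` has no large panel in a copy of the first `K` columns, then `S` can be cut
in two inside the copy, with a bounded number of types across the cut, the first column on the
left side and the last column on the right side. In a strip with no full row on some run, each row
is cut at a missing vertex in this run. -/
theorem exists_cut_of_strips (δ : Triple) {S : Set (ℕ × ℕ)} {K x n : ℕ} (hK : 2 ≤ K)
    (hx : δ.SameFactor K 0 x) (s : ℕ → ℕ) (hmono : Monotone s) (hsn : ∀ j, s j < n)
    (hs : ∀ j, (∀ j', s j' = s j → j' = j) ∨
      ∃ u < K, ∀ j', s j' = s j → ¬ δ.FullRow S K x u j') :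
    ∃ L : Set (ℕ × ℕ), (∀ p ∈ S, p.1 = x → p ∈ L) ∧ (∀ p ∈ S, p.1 + 1 = x + K → p ∉ L) ∧
      Homog δ.grid {p | p ∈ S ∧ p ∈ L ∧ x ≤ p.1 ∧ p.1 < x + K}
        {p | p ∈ S ∧ p ∉ L ∧ x ≤ p.1 ∧ p.1 < x + K} (K * n) := by
  have hU : ∀ t, ∃ u, ∀ j, s j = t → (∀ j', s j' = s j → j' = j) ∨ ¬ δ.FullRow S K x u j := by
    intro t
    by_cases ht : ∃ j, s j = t
    · obtain ⟨j, rfl⟩ := ht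
      rcases hs j with h | ⟨u, -, h⟩
      · exact ⟨0, fun j' e => Or.inl fun j'' e' => by rw [h j'' (e'.trans e), h j' e]⟩
      · exact ⟨u, fun j' e => Or.inr (h j' e)⟩
    · exact ⟨0, fun j e => (ht ⟨j, e⟩).elim⟩
  choose U hU using hU
  -- row `j` is cut at column `x + d`; a strip with a single row is cut after the first column
  have hd : ∀ j, ∃ d, ((∀ j', s j' = s j → j' = j) ∧ d = 1) ∨
      (¬ (∀ j', s j' = s j → j' = j) ∧ d < K ∧ δ.run d = U (s j) ∧ (x + d, j) ∉ S) := by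
    intro j
    by_cases hj : ∀ j', s j' = s j → j' = j
    · exact ⟨1, Or.inl ⟨hj, rfl⟩⟩
    · have := (hU (s j) j rfl).resolve_left hj
      simp only [FullRow, not_forall] at this
      obtain ⟨d, h1, h2, h3⟩ := this
      exact ⟨d, Or.inr ⟨hj, h1, h2, h3⟩⟩
  choose d hd using hd
  refine ⟨{p | p.1 < x + d p.2}, ?_, ?_, ?_⟩
  · rintro ⟨c, j⟩ hp rfl
    rcases hd j with ⟨-, h⟩ | ⟨-, -, -, h⟩
    · simp [h]
    · have : d j ≠ 0 := fun h0 => h (by simpa [h0] using hp)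
      simp only [Set.mem_ofPred_eq]
      omega
  · rintro ⟨c, j⟩ hp hc hL
    simp only [Set.mem_ofPred_eq] at hc hL
    rcases hd j with ⟨-, h⟩ | ⟨-, h, -⟩ <;> omega
  · refine Homog.of_image (fun p => (p.1 - x, s p.2)) (Set.Iio K ×ˢ Set.Iio n)
      ((Set.finite_Iio K).prod (Set.finite_Iio n)) (by simp [Set.ncard_prod]) ?_ ?_
    · rintro ⟨c, j⟩ ⟨-, -, h1, h2⟩
      refine ⟨?_, hsn j⟩
      simp only [Set.mem_Iio] at *
      omega
    rintro ⟨c, j⟩ ⟨-, hpL, hp1, hp2⟩ ⟨c', j'⟩ ⟨-, hpL', hp1', -⟩ e ⟨i, l⟩ ⟨hq, hqL, hq1, hq2⟩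
    obtain ⟨e1, e2⟩ := Prod.mk.inj e
    dsimp only at *
    obtain rfl : c = c' := by omega
    simp only [Set.mem_ofPred_eq] at hpL hpL' hqL
    rcases lt_trichotomy (s j) (s l) with hjl | hjl | hjl
    · exact δ.grid_adj_congr_of_lt (hmono.reflect_lt hjl) (hmono.reflect_lt (e2 ▸ hjl))
    swap
    · rw [δ.grid.adj_comm, δ.grid.adj_comm (c, j')]
      exact δ.grid_adj_congr_of_lt (hmono.reflect_lt hjl) (hmono.reflect_lt (e2 ▸ hjl))
    by_cases hj : ∀ j', s j' = s j → j' = j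
    · rw [hj j' e2.symm]
    have hl : ¬ ∀ j', s j' = s l → j' = l := fun h => hj fun j'' e' => by
      rw [h j'' (e'.trans hjl), h j hjl]
    obtain ⟨-, hdj, hrj, -⟩ := (hd j).resolve_left fun h => hj h.1
    obtain ⟨-, hdl, hrl, hSl⟩ := (hd l).resolve_left fun h => hl h.1
    have hil : i ≠ x + d l := fun e => hSl (e ▸ hq)
    -- a link crossing the cut inside the strip lies in the run where the strip is cut
    have hletter : ∀ m, d l ≤ m → m + 1 ≤ d j → ¬ 2 ≤ δ.α (x + m) := fun m h1 h2 h3 => by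
      have hα : δ.α m = δ.α (x + m) := by simpa using hx.1 m (by omega)
      have hm := δ.run_succ m
      have := δ.run_mono h1
      have := δ.run_mono h2
      rw [hα, if_pos h3] at hm
      rw [hjl] at hrj
      omega
    have hne : ∀ j, c < x + d j → c ≤ i + 1 → i ≤ c + 1 → j ≠ l := fun j h1 h2 h3 e => by
      subst e
      omega
    refine δ.grid_adj_congr (fun e => ?_) (fun e => ?_) (fun e => ?_)
    · have hlt := hletter (c - x) (by omega) (by omega)
      rw [Nat.add_sub_cancel' hp1] at hlt
      exact (linkAdj_ne hlt (hne j hpL (by omega) (by omega))).trans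
        (linkAdj_ne hlt (hne j' hpL' (by omega) (by omega))).symm
    · have hlt := hletter (i - x) (by omega) (by omega)
      rw [Nat.add_sub_cancel' hq1] at hlt
      exact (linkAdj_ne hlt (hne j hpL (by omega) (by omega)).symm).trans
        (linkAdj_ne hlt (hne j' hpL' (by omega) (by omega)).symm).symm
    · exact iff_of_false (hne j hpL (by omega) (by omega)) (hne j' hpL' (by omega) (by omega))

/-! ### The ordering of the vertices -/

theorem copyEnd_succ (δ : Triple) (hrec : δ.IsRecurrent) {j k : ℕ} (hk : 2 ≤ k) (i : ℕ) :
    δ.copyEnd j k i + k < δ.copyEnd j k (i + 1) ∧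
      δ.SameFactor k j (δ.copyEnd j k (i + 1) - k) := by
  have hne : {t : ℕ | δ.copyEnd j k i + k < t ∧ δ.SameFactor k j (t - k)}.Nonempty := by
    obtain ⟨x, hx, hlt⟩ := (hrec k hk j).exists_gt (δ.copyEnd j k i)
    exact ⟨x + k, by omega, by simpa using hx⟩
  exact Nat.sInf_mem hne

theorem mem_gap (δ : Triple) {j k i c : ℕ} :
    c ∈ δ.gap j k i ↔ δ.copyEnd j k i - k ≤ c ∧ c < δ.copyEnd j k (i + 1) := by
  cases i <;> simp [gap, copyEnd]

/-- The ordering: suppose that `S` is cut in each copy (`L i` being the left side of the cut in the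
copy that ends before column `t i`), and order `S` gap by gap, and by rows inside a gap. Then every
cut of the ordering has boundedly many types. Here `g p` is the gap between cuts to which `p`
belongs. No copy is needed before the first gap: if `t 0 = 0`, then `t 0 - K = 0` by truncation, and
the hypotheses on `L 0` are vacuous. -/
theorem homog_of_gaps (δ : Triple) {B C N K n : ℕ} (hK : 0 < K) (hB : ∀ n, 2 ≤ n → δ.M n < B)
    {S : Set (ℕ × ℕ)} (hS : ∀ p ∈ S, p.1 < n) (t : ℕ → ℕ) (ht : ∀ i, t i + K < t (i + 1))
    (hN : ∀ i, δ.N (Finset.Ico (t i - K) (t (i + 1))) ≤ N) (L : ℕ → Set (ℕ × ℕ))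
    (hfirst : ∀ i, ∀ p ∈ S, p.1 = t i - K → p.1 < t i → p ∈ L i)
    (hlast : ∀ i, ∀ p ∈ S, p.1 + 1 = t i → p ∉ L i)
    (hcut : ∀ i, Homog δ.grid {p | p ∈ S ∧ p ∈ L i ∧ t i - K ≤ p.1 ∧ p.1 < t i}
      {p | p ∈ S ∧ p ∉ L i ∧ t i - K ≤ p.1 ∧ p.1 < t i} C)
    (g : ℕ × ℕ → ℕ)
    (hg : ∀ p i, g p < i ↔ p.1 < t i - K ∨ (p.1 < t i ∧ p ∈ L i)) (v : ℕ × ℕ) :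
    Homog δ.grid
      {p | p ∈ S ∧ (g p < g v ∨ (g p = g v ∧ (p.2 < v.2 ∨ (p.2 = v.2 ∧ p.1 ≤ v.1))))}
      {p | p ∈ S ∧ (g v < g p ∨ (g p = g v ∧ (v.2 < p.2 ∨ (p.2 = v.2 ∧ v.1 < p.1))))}
      (B * ((B + C) * (B + (C * B + N * (N + (B + 1)))))) := by
  obtain ⟨c, r⟩ := v
  generalize g (c, r) = i
  dsimp only
  set X := {p | p ∈ S ∧ (g p < i ∨ (g p = i ∧ (p.2 < r ∨ (p.2 = r ∧ p.1 ≤ c))))}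
  set Y := {p | p ∈ S ∧ (i < g p ∨ (g p = i ∧ (r < p.2 ∨ (p.2 = r ∧ c < p.1))))}
  have hti := ht i
  have hXc : ∀ p ∈ X, p.1 < t (i + 1) - K ∨ (p.1 < t (i + 1) ∧ p ∈ L (i + 1)) := fun p hp =>
    (hg p (i + 1)).1 (by have := hp.2; omega)
  have hYc : ∀ p ∈ Y, t i - K ≤ p.1 ∧ (p.1 < t i → p ∉ L i) := fun p hp => by
    have : ¬ g p < i := by have := hp.2; omega
    rw [hg, not_or, not_and, not_lt] at this
    exact this
  -- the part of `Y` inside the gap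
  set Z := {p | p ∈ Y ∧ g p = i} with hZ
  have hZr : ∀ p ∈ Z, r < p.2 ∨ (p.2 = r ∧ c < p.1) := fun p hp => by
    have h1 := hp.1.2
    have h2 := hp.2
    omega
  have hgap : ∀ p, g p = i → t i - K ≤ p.1 ∧ p.1 < t (i + 1) := fun p hp => by
    have h1 := hg p i
    have h2 := (hg p (i + 1)).1 (by omega)
    omega
  have hY : Y ⊆ {p | p ∈ S ∧ t (i + 1) ≤ p.1} ∪
      ({p | p ∈ S ∧ p ∉ L (i + 1) ∧ t (i + 1) - K ≤ p.1 ∧ p.1 < t (i + 1)} ∪ Z) := by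
    intro p hp
    rcases hp.2 with h | h
    · have h1 : ¬ g p < i + 1 := by omega
      rw [hg, not_or, not_and, not_lt] at h1
      by_cases h2 : p.1 < t (i + 1)
      · exact Or.inr (Or.inl ⟨hp.1, h1.2 h2, h1.1, h2⟩)
      · exact Or.inl ⟨hp.1, not_lt.1 h2⟩
    · exact Or.inr (Or.inr ⟨hp, h.1⟩)
  refine Homog.mono (Homog.union_right ?_ (Homog.union_right ?_ ?_)) subset_rfl hY le_rfl
  -- the columns beyond the gap
  · refine δ.homog_of_bonds hB (t (i + 1)) n (fun p hp => ?_) (fun p hp => ⟨hp.2, hS p hp.1⟩)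
      fun p hp q hq e => ?_
    · have := hXc p hp
      omega
    · have h1 := hXc p hp
      have h2 := hq.2
      refine hlast (i + 1) p hp.1 ?_ (h1.resolve_left ?_).2 <;> omega
  -- the right side of the cut at the end of the gap
  · refine Homog.mono (Homog.union_left (X₁ := {p | p ∈ S ∧ p.1 < t (i + 1) - K}) ?_
      (hcut (i + 1))) (fun p hp => ?_) subset_rfl le_rfl
    · refine δ.homog_of_bonds hB (t (i + 1) - K) n (fun p hp => hp.2)
        (fun p hp => ⟨hp.2.2.1, hS p hp.1⟩) fun p hp q hq e => ?_
      have h1 := hp.2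
      have h2 := hq.2.2
      exact hq.2.1 (hfirst (i + 1) q hq.1 (by omega) h2.2)
    · by_cases h : p.1 < t (i + 1) - K
      · exact Or.inl ⟨hp.1, h⟩
      · have := (hXc p hp).resolve_left h
        exact Or.inr ⟨hp.1, this.2, not_lt.1 h, this.1⟩
  -- the rest of the gap
  have hX : X ⊆ {p | p ∈ S ∧ p.1 < t i - K} ∪
      ({p | p ∈ S ∧ p ∈ L i ∧ t i - K ≤ p.1 ∧ p.1 < t i} ∪ {p | p ∈ X ∧ g p = i}) := by
    intro p hp
    rcases hp.2 with h | h
    · rw [hg] at h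
      by_cases h2 : p.1 < t i - K
      · exact Or.inl ⟨hp.1, h2⟩
      · have := h.resolve_left h2
        exact Or.inr (Or.inl ⟨hp.1, this.2, not_lt.1 h2, this.1⟩)
    · exact Or.inr (Or.inr ⟨hp, h.1⟩)
  refine Homog.mono (Homog.union_left ?_ (Homog.union_left ?_ ?_)) hX subset_rfl le_rfl
  -- the columns before the gap
  · refine δ.homog_of_bonds hB (t i - K) n (fun p hp => hp.2)
      (fun p hp => ⟨(hYc p hp.1).1, hS p hp.1.1⟩) fun p hp q hq e => ?_
    have h1 := hp.2
    have h2 := hYc q hq.1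
    exact h2.2 (by omega) (hfirst i q hq.1.1 (by omega) (by omega))
  -- the left side of the cut at the beginning of the gap
  · refine Homog.mono (Homog.union_right (hcut i) (δ.homog_of_bonds hB
      (Y := {p | p ∈ S ∧ t i ≤ p.1}) (t i) n (fun p hp => hp.2.2.2)
      (fun p hp => ⟨hp.2, hS p hp.1⟩) fun p hp q hq e => ?_))
      subset_rfl (fun p hp => ?_) le_rfl
    · have h1 := hp.2.2.2
      have h2 := hq.2
      exact hlast i p hp.1 (by omega) hp.2.1
    · have h1 := hYc p hp.1
      by_cases h : p.1 < t i
      · exact Or.inl ⟨hp.1.1, h1.2 h, h1.1, h⟩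
      · exact Or.inr ⟨hp.1.1, not_lt.1 h⟩
  -- the part of the gap that comes first in the ordering
  have hXr : ∀ p, p ∈ X ∧ g p = i → p.2 < r ∨ (p.2 = r ∧ p.1 ≤ c) := fun p hp => by
    have h1 := hp.1.2
    have h2 := hp.2
    omega
  have hrows : ∀ X' Y' : Set (ℕ × ℕ), (∀ p ∈ X', g p = i) → (∀ p ∈ Y', g p = i) →
      (∀ p ∈ X', ∀ q ∈ Y', p.2 < q.2) → Homog δ.grid X' Y' N := fun X' Y' h1 h2 h3 =>
    (δ.homog_of_rows (Finset.Ico (t i - K) (t (i + 1)))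
      (fun p hp => Finset.mem_Ico.2 (hgap p (h1 p hp)))
      (fun p hp => Finset.mem_Ico.2 (hgap p (h2 p hp))) h3).mono subset_rfl subset_rfl (hN i)
  refine Homog.mono (Homog.union_right (Y₁ := {p | g p = i ∧ r < p.2})
    (Y₂ := {p | p ∈ S ∧ g p = i ∧ p.2 = r ∧ c < p.1}) ?_ ?_) subset_rfl (fun p hp => ?_) le_rfl
  · refine hrows _ _ (fun p hp => hp.2) (fun p hp => hp.1) fun p hp q hq => ?_
    have h1 := hXr p hp
    have h2 := hq.2
    omega
  · refine Homog.mono (Homog.union_left (X₁ := {p | g p = i ∧ p.2 < r}) ?_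
      (Homog.union_left (X₁ := {p | p.1 < c}) ?_ (Homog.singleton (c, r))))
      (fun p hp => ?_) subset_rfl le_rfl
    · refine hrows _ _ (fun p hp => hp.1) (fun p hp => hp.2.1) fun p hp q hq => ?_
      have h1 := hp.2
      have h2 := hq.2.2.1
      omega
    · refine δ.homog_of_bonds hB (c + 1) n (fun p hp => Nat.lt_succ_of_lt hp)
        (fun p hp => ⟨hp.2.2.2, hS p hp.1⟩) fun p hp q hq => ?_
      have h1 : p.1 < c := hp
      have h2 := hq.2.2.2
      omega
    · rcases hXr p hp with h | ⟨h1, h2⟩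
      · exact Or.inl ⟨hp.2, h⟩
      · rcases h2.lt_or_eq with h | h
        · exact Or.inr (Or.inl h)
        · exact Or.inr (Or.inr (Prod.ext h h1))
  · rcases hZr p hp with h | h
    · exact Or.inl ⟨hp.2, h⟩
    · exact Or.inr ⟨hp.1.1, hp.2, h⟩

/-- Linear clique-width is bounded on the graphs that embed in the grid without containing a panel,
that is, an image of the first `h` rows of the first `K` columns. The other assumptions are those
in the definition of `Δ_min`. -/
theorem exists_lcw_bound (δ : Triple) (hrec : δ.IsRecurrent) (hM : δ.BoundedM) {K : ℕ}
    (hK : 2 ≤ K) (hgap : δ.BoundedGapN 0 K) (h : ℕ) :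
    ∃ b, ∀ (V : Type) [Finite V] (G : SimpleGraph V) (f : G ↪g δ.grid),
      (¬ ∃ φ : ℕ × ℕ → ℕ × ℕ, ∀ p : ℕ × ℕ, p.1 < K → p.2 < h → φ p ∈ Set.range f ∧
        ∀ q : ℕ × ℕ, q.1 < K → q.2 < h →
          (φ p = φ q → p = q) ∧ (δ.grid.Adj (φ p) (φ q) ↔ δ.grid.Adj p q)) →
      lcw G ≤ b := by
  classical
  obtain ⟨B, hB⟩ := hM
  obtain ⟨N, hN⟩ := hgap
  set C := K * (2 * (h * (K + 1)) + 1) with hC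
  refine ⟨2 * (B * ((B + C) * (B + (C * B + N * (N + (B + 1)))))) + 1, fun V _ G f hno => ?_⟩
  set S := Set.range f with hSdef
  obtain ⟨n, hn⟩ : ∃ n, ∀ p ∈ S, p.1 < n := by
    obtain ⟨n, hn⟩ := ((Set.finite_range f).image Prod.fst).bddAbove
    exact ⟨n + 1, fun p hp => Nat.lt_succ_of_le (hn ⟨p, hp, rfl⟩)⟩
  set t := δ.copyEnd 0 K with htdef
  have ht0 : t 0 = 0 := rfl
  have ht : ∀ i, t i + K < t (i + 1) := fun i => (δ.copyEnd_succ hrec hK i).1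
  have hcopy : ∀ x, δ.SameFactor K 0 x →
      ∃ L : Set (ℕ × ℕ), (∀ p ∈ S, p.1 = x → p ∈ L) ∧ (∀ p ∈ S, p.1 + 1 = x + K → p ∉ L) ∧
      Homog δ.grid {p | p ∈ S ∧ p ∈ L ∧ x ≤ p.1 ∧ p.1 < x + K}
        {p | p ∈ S ∧ p ∉ L ∧ x ≤ p.1 ∧ p.1 < x + K} C := fun x hx => by
    rcases exists_blocks_or_strips K (δ.FullRow S K x) (h * (K + 1)) 0 with
      ⟨ρ, h1, h2⟩ | ⟨s, h1, h2, h3⟩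
    · exact (hno (δ.exists_embedding_of_blocks hx ρ (fun t ht u hu => (h1 t ht u hu).2) h2)).elim
    · exact δ.exists_cut_of_strips hK hx s (fun j j' hj => h1 j j' (Nat.zero_le _) hj) h2
        fun j => by simpa using h3 j (Nat.zero_le _)
  have hL : ∀ i, ∃ L : Set (ℕ × ℕ), (∀ p ∈ S, p.1 = t i - K → p.1 < t i → p ∈ L) ∧
      (∀ p ∈ S, p.1 + 1 = t i → p ∉ L) ∧
      Homog δ.grid {p | p ∈ S ∧ p ∈ L ∧ t i - K ≤ p.1 ∧ p.1 < t i}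
        {p | p ∈ S ∧ p ∉ L ∧ t i - K ≤ p.1 ∧ p.1 < t i} C := fun i => by
    cases i with
    | zero =>
      refine ⟨∅, fun p _ _ h => ?_, fun p _ _ => Set.notMem_empty p, ⟨fun _ => 0, ?_, ?_⟩⟩
      · rw [ht0] at h
        omega
      all_goals exact fun p hp => hp.2.1.elim
    | succ i =>
      obtain ⟨L, h1, h2, h3⟩ := hcopy _ (δ.copyEnd_succ hrec hK i).2
      have hle : K ≤ t (i + 1) := by have := ht i; omega
      rw [← htdef, Nat.sub_add_cancel hle] at h2 h3
      exact ⟨L, fun p hp e _ => h1 p hp e, h2, h3⟩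
  choose L hfirst hlast hcut using hL
  -- the vertices before the cut in the copy that ends before column `t i`
  set A : ℕ → Set (ℕ × ℕ) := fun i => {p | p.1 < t i - K ∨ (p.1 < t i ∧ p ∈ L i)} with hA
  have hAmono : Monotone A := monotone_nat_of_le_succ fun i p hp => by
    have := ht i
    have : p.1 < t i := by rcases hp with h | h <;> omega
    exact Or.inl (by omega)
  have hA0 : ∀ p, p ∉ A 0 := fun p hp => by
    have : p.1 < 0 - K ∨ (p.1 < 0 ∧ p ∈ L 0) := hp
    omega
  have hti : ∀ i, i ≤ t i := fun i => by
    induction i with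
    | zero => exact Nat.zero_le _
    | succ i ih => have := ht i; omega
  have hex : ∀ p : ℕ × ℕ, ∃ i, p ∈ A (i + 1) := fun p =>
    ⟨p.1, Or.inl (by have := ht p.1; have := hti p.1; omega)⟩
  set g : ℕ × ℕ → ℕ := fun p => Nat.find (hex p) with hgdef
  have hg : ∀ p i, g p < i ↔ p ∈ A i := fun p i => by
    refine ⟨fun hlt => hAmono hlt (Nat.find_spec (hex p)), fun hp => ?_⟩
    cases i with
    | zero => exact (hA0 p hp).elim
    | succ i => exact Nat.lt_succ_of_le (Nat.find_min' (hex p) hp)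
  have hN' : ∀ i, δ.N (Finset.Ico (t i - K) (t (i + 1))) ≤ N := fun i => by
    have e : Finset.Ico (t i - K) (t (i + 1)) = δ.gap 0 K i := by
      ext c
      rw [Finset.mem_Ico, δ.mem_gap]
    rw [e]
    exact (Finset.le_sup (f := fun i => δ.N (δ.gap 0 K i)) (Finset.self_mem_range_succ i)).trans
      (hN (i + 1))
  refine lcw_le_of_key G (fun u => toLex (g (f u), toLex ((f u).2, (f u).1))) (fun u w e => ?_) _
    fun v => ?_
  · have e1 := (Prod.mk.inj (toLex.injective e)).2
    have e2 := Prod.mk.inj (toLex.injective e1)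
    exact f.injective (Prod.ext e2.2 e2.1)
  · refine (δ.homog_of_gaps (by omega) hB hn t ht hN' L hfirst hlast hcut g hg (f v)).comap f ?_ ?_
    · intro u hu
      refine ⟨⟨u, rfl⟩, ?_⟩
      simpa [Prod.Lex.toLex_le_toLex] using hu
    · intro u hu
      refine ⟨⟨u, rfl⟩, ?_⟩
      have : g (f v) < g (f u) ∨ g (f v) = g (f u) ∧
          ((f v).2 < (f u).2 ∨ (f v).2 = (f u).2 ∧ (f v).1 < (f u).1) := by
        simpa [Prod.Lex.toLex_lt_toLex] using hu
      simpa only [eq_comm] using this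

/-! ### Minimality -/

theorem graphClass_isHereditary (δ : Triple) : δ.graphClass.IsHereditary :=
  fun _ _ _ _ _ _ ⟨f⟩ ⟨e⟩ => ⟨f.comp e⟩

theorem boundedLcw_of_isProperSubclass (δ : Triple) (hδ : δ ∈ DeltaMin) (D : GraphClass)
    (hD : D.IsHereditary) (hsub : D.IsProperSubclass δ.graphClass) : D.BoundedLcw := by
  obtain ⟨-, hrec, hgap, hM⟩ := hδ
  obtain ⟨hDδ, hδD⟩ := hsub
  simp only [GraphClass.IsSubclass, not_forall] at hδD
  -- a graph `H` of the class outside `D`; it lies in the first `K` columns and `h` rows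
  obtain ⟨W, hW, H, ⟨e⟩, hHD⟩ := hδD
  obtain ⟨K, hK⟩ := ((Set.finite_range e).image Prod.fst).bddAbove
  obtain ⟨h, hh⟩ := ((Set.finite_range e).image Prod.snd).bddAbove
  have he1 : ∀ w, (e w).1 < K + 2 := fun w => by
    have := hK ⟨e w, ⟨w, rfl⟩, rfl⟩
    omega
  have he2 : ∀ w, (e w).2 < h + 1 := fun w => by
    have := hh ⟨e w, ⟨w, rfl⟩, rfl⟩
    omega
  obtain ⟨b, hb⟩ := δ.exists_lcw_bound hrec hM (K := K + 2) (by omega)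
    (hgap (K + 2) (by omega) 0) (h + 1)
  refine ⟨b, fun V _ G hG => ?_⟩
  obtain ⟨f⟩ := hDδ V G hG
  refine hb V G f fun ⟨φ, hφ⟩ => hHD (hD W V H G hG ?_)
  have hmem : ∀ w, ∃ v, f v = φ (e w) := fun w => (hφ (e w) (he1 w) (he2 w)).1
  choose ψ hψ using hmem
  refine ⟨⟨⟨ψ, fun w w' hw => ?_⟩, fun {w w'} => ?_⟩⟩
  · refine e.injective (((hφ _ (he1 w) (he2 w)).2 _ (he1 w') (he2 w')).1 ?_)
    rw [← hψ, ← hψ, hw]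
  · change G.Adj (ψ w) (ψ w') ↔ _
    rw [← f.map_adj_iff, hψ, hψ, ((hφ _ (he1 w) (he2 w)).2 _ (he1 w') (he2 w')).2, e.map_adj_iff]

end Triple

theorem GraphClass.BoundedLcw.boundedCwd {C : GraphClass} (h : C.BoundedLcw) : C.BoundedCwd :=
  h.imp fun _ hK V _ G hG => (cwd_le_lcw G).trans (hK V G hG)

end GridClass

theorem mainTheorem2 (δ : GridClass.Triple) (hδ : δ ∈ GridClass.Triple.DeltaMin) :
    δ.graphClass.IsMinimalUnboundedCwd ∧ δ.graphClass.IsMinimalUnboundedLcw :=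
  ⟨⟨δ.graphClass_isHereditary, hδ.1,
      fun D hD hsub => (δ.boundedLcw_of_isProperSubclass hδ D hD hsub).boundedCwd⟩,
    ⟨δ.graphClass_isHereditary, fun h => hδ.1 h.boundedCwd,
      fun D hD hsub => δ.boundedLcw_of_isProperSubclass hδ D hD hsub⟩⟩
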